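/- **Setting.** Let $n\ge 1$ and $\alpha\in[0,1]$. Facilities $1,\dots,n$ choose locations $s=(s_1,\dots,s_n)\in[0,1]^n$. A choice function $f$ assigns to every location vector $s$ and every client $z\in[0,1]$ a facility $f(s,z)\in\{1,\dots,n\}$. It is *measurable* if, for each $s$ and $i$, the clients selecting $i$ form a finite disjoint union of intervals; the load $\ell_i(s,f)$ is the total length of these intervals and is also the utility of facility $i$. The cost of client $z$ is $$C_z(s,f)=(1-\alpha)\,|s_{f(s,z)}-z|+\alpha\,\ell_{f(s,z)}(s,f).$$ A measurable $f$ is a *client equilibrium in every subgame* if, for every $s\in[0,1]^n$ and every $z\in[0,1]$, client $z$ cannot lower $C_z(s,f)$ by selecting another facility while all other clients keep their choices. It is *proper* if, for every $s$, there are an ordering of the facilities by location, $s_{\sigma(1)}\le\dots\le s_{\sigma(n)}$, and borders $0=\beta_0\le\beta_1\le\dots\le\beta_n=1$ such that all clients who select facility $\sigma(k)$ lie in $[\beta_{k-1},\beta_k]$. For real $\rho$, a profile $(s,f)$ with $f$ measurable is a *$\rho$-approximate pure subgame perfect equilibrium* ($\rho$-SPE) if $f$ is a client equilibrium in every subgame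 and, for every facility $i$ and every $s_i'\in[0,1]$, $$\ell_i((s_{-i},s_i'),f)\le\rho\cdot\ell_i(s,f).$$ **Theorem.** Let $4\le n\le 10$, let $s_{\mathrm{opt}}=(s_1,\dots,s_n)$ with $s_i=\frac{2i-1}{2n}$, and let $\rho_n=\rho_n(\alpha)$ be given by $$\rho_4=\frac12+\frac{2(\alpha^2-2)}{(\alpha-1)\alpha(4+\alpha)-4},$$ $$\rho_5=\frac{12+\alpha(4+\alpha(\alpha(\alpha-2)-10))}{8+\alpha(2+\alpha)(4+(\alpha-6)\alpha)},$$ $$\rho_6=\frac12+\frac{16-16\alpha^2+3\alpha^4}{16+\alpha(16+\alpha(\alpha(\alpha(5+\alpha)-12)-20))},$$ $$\rho_7=\frac{\alpha(\alpha(64+\alpha(16+\alpha(\alpha(\alpha-3)-21)))-16)-48}{\alpha(\alpha(48+\alpha(32+\alpha((\alpha-6)\alpha-18)))-32)-32},$$ $$\rho_8=\frac12+\frac{4(\alpha^2-2)(8-8\alpha^2+\alpha^4)}{\alpha((\alpha-2)\alpha(2+\alpha)(\alpha(\alpha(7+\alpha)-20)-28)-64)-64},$$ $$\rho_9=\frac{192+\alpha(64+\alpha(\alpha(4+\alpha)(\alpha(56+\alpha((\alpha-8)\alpha-4))-24)-352))}{128+(\alpha-2)\alpha(\alpha(2+\alpha)(48+\alpha(48+\alpha((\alpha-8)\alpha-28)))-64)},$$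 $$\rho_{10}=\frac12+\frac{256-512\alpha^2+336\alpha^4-80\alpha^6+5\alpha^8}{256+\alpha(256+\alpha(\alpha(\alpha(432+\alpha(240+\alpha(\alpha(9\alpha+\alpha^2-40)-120)))-448)-576))}.$$ Then, for every $\alpha\in[0,1]$, there is a proper choice function $f$ such that $(s_{\mathrm{opt}},f)$ is a $\rho_n(\alpha)$-SPE. Moreover, if $\alpha>0$, then $(s_{\mathrm{opt}},f)$ is a $\rho_n(\alpha)$-SPE for every measurable choice function $f$ that is a client equilibrium in every subgame. Finally, $\rho_n(\alpha)\to\frac32$ as $\alpha\downarrow 0$. -/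

import Mathlib

open MeasureTheory Filter Topology

/-- Location vectors of `n` facilities in the linear market `[0,1]`
(indices start at `0`, so facility `i ∈ {1, …, n}` has index `i - 1`). -/
abbrev Placement (n : ℕ) : Type := Fin n → unitInterval

/-- A client mapping for one fixed location vector: the client at `z ∈ [0,1]` selects a facility. -/
abbrev ClientMap (n : ℕ) : Type := unitInterval → Fin n

/-- A choice function of the clients: a client mapping for every location vector. -/
abbrev ChoiceFunction (n : ℕ) : Type := Placement n → ClientMap n

/-- For every facility, the clients that select it form a finite disjoint union of intervals. -/
def ClientMap.IsMeasurableMap {n : ℕ} (g : ClientMap n) : Prop :=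
  ∀ i : Fin n, ∃ J : Set (Set unitInterval),
    J.Finite ∧ J.PairwiseDisjoint id ∧ (∀ A ∈ J, A.OrdConnected) ∧ {z | g z = i} = ⋃₀ J

/-- The load (which is also the utility) of facility `i`: the total length of the set of clients
that select it. -/
noncomputable def ClientMap.load {n : ℕ} (g : ClientMap n) (i : Fin n) : ℝ :=
  (volume : Measure unitInterval).real {z | g z = i}

/-- The cost of the client at `z`. -/
noncomputable def ClientMap.cost {n : ℕ} (α : ℝ) (s : Placement n) (g : ClientMap n)
    (z : unitInterval) : ℝ :=
  (1 - α) * |(s (g z) : ℝ) - (z : ℝ)| + α * g.load (g z)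

/-- No single client can lower her cost by selecting another facility. -/
noncomputable def ClientMap.IsClientEquilibrium {n : ℕ} (α : ℝ) (s : Placement n)
    (g : ClientMap n) : Prop :=
  ∀ (z : unitInterval) (j : Fin n),
    g.cost α s z ≤ ClientMap.cost α s (Function.update g z j) z

/-- After sorting the facilities by location, `[0,1]` is cut at `0 = β₀ ≤ β₁ ≤ … ≤ βₙ = 1` into
consecutive closed intervals, and every client who selects the `k`-th facility lies in the `k`-th
interval. -/
def ClientMap.IsProper {n : ℕ} (s : Placement n) (g : ClientMap n) : Prop :=
  ∃ (σ : Equiv.Perm (Fin n)) (β : Fin (n + 1) → ℝ),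
    Monotone (fun k => s (σ k)) ∧ Monotone β ∧ β 0 = 0 ∧ β (Fin.last n) = 1 ∧
    ∀ (z : unitInterval) (k : Fin n),
      g z = σ k → β k.castSucc ≤ (z : ℝ) ∧ (z : ℝ) ≤ β k.succ

/-- The choice function is measurable and a client equilibrium in every subgame. -/
def ChoiceFunction.IsSubgameEquilibrium {n : ℕ} (α : ℝ) (f : ChoiceFunction n) : Prop :=
  ∀ s : Placement n, (f s).IsMeasurableMap ∧ (f s).IsClientEquilibrium α s

/-- `(s, f)` is a `ρ`-approximate pure subgame perfect equilibrium: no facility can increase her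
utility by more than the factor `ρ` by moving to another location, and for every location vector
the clients are in equilibrium. -/
def IsApproxSPE {n : ℕ} (ρ α : ℝ) (s : Placement n) (f : ChoiceFunction n) : Prop :=
  (∀ (i : Fin n) (x : unitInterval),
    (f (Function.update s i x)).load i ≤ ρ * (f s).load i) ∧
  f.IsSubgameEquilibrium α

/-- The uniform placement `s_i = (2i - 1) / (2n)`, `1 ≤ i ≤ n`. -/
noncomputable def sOpt (n : ℕ) : Placement n := fun i =>
  ⟨(2 * ((i : ℕ) + 1 : ℝ) - 1) / (2 * (n : ℝ)), by
    have h : ((i : ℕ) : ℝ) + 1 ≤ (n : ℝ) := by exact_mod_cast i.isLt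
    have h0 : (0 : ℝ) ≤ ((i : ℕ) : ℝ) := Nat.cast_nonneg _
    constructor
    · apply div_nonneg <;> linarith
    · rw [div_le_one (by linarith)]
      linarith⟩

/-- The factors `ρ_n(α)` for `4 ≤ n ≤ 10` (the value for other `n` is irrelevant). -/
noncomputable def rhoOpt (n : ℕ) (α : ℝ) : ℝ :=
  match n with
  | 4 => 1 / 2 + 2 * (α ^ 2 - 2) / ((α - 1) * α * (4 + α) - 4)
  | 5 => (12 + α * (4 + α * (α * (α - 2) - 10))) / (8 + α * (2 + α) * (4 + (α - 6) * α))
  | 6 => 1 / 2 + (16 - 16 * α ^ 2 + 3 * α ^ 4) /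
      (16 + α * (16 + α * (α * (α * (5 + α) - 12) - 20)))
  | 7 => (α * (α * (64 + α * (16 + α * (α * (α - 3) - 21))) - 16) - 48) /
      (α * (α * (48 + α * (32 + α * ((α - 6) * α - 18))) - 32) - 32)
  | 8 => 1 / 2 + 4 * (α ^ 2 - 2) * (8 - 8 * α ^ 2 + α ^ 4) /
      (α * ((α - 2) * α * (2 + α) * (α * (α * (7 + α) - 20) - 28) - 64) - 64)
  | 9 => (192 + α * (64 + α * (α * (4 + α) * (α * (56 + α * ((α - 8) * α - 4)) - 24) - 352))) /
      (128 + (α - 2) * α * (α * (2 + α) * (48 + α * (48 + α * ((α - 8) * α - 28))) - 64))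
  | 10 => 1 / 2 + (256 - 512 * α ^ 2 + 336 * α ^ 4 - 80 * α ^ 6 + 5 * α ^ 8) /
      (256 + α * (256 + α * (α * (α * (432 + α * (240 + α * (α * (9 * α + α ^ 2 - 40) - 120)))
        - 448) - 576)))
  | _ => 1

/-! For sorted locations `t 0 ≤ … ≤ t (n - 1)`, a client equilibrium arises from borders `β` at
which the client is indifferent between the two neighbouring facilities (`IsBorderSystem`). This is
a second-order recursion for `β` with prescribed values at both ends, solved by shooting
(`exists_isBorderSystem`). For `α > 0` all equilibria of a subgame have the same loads
(`ClientMap.IsClientEquilibrium.load_eq`), so bounds for this equilibrium hold for every choice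
function. For `α = 0` the midpoint borders are used.

At the uniform placement every load is `1 / n`. After a deviation, all facilities on one side of the
deviator, say the right, stand at their uniform places, and those on the other side are no further
away from it than before. If the left border of the deviator lies left of its uniform position, its
load is at most `1 / n`. Otherwise its excess load is at most the displacement of its right border.
Displacements `e k = β k - k / n` satisfy `2 * e (k + 1) = α * (e k + e (k + 2))` near the uniform
borders and vanish at `n`, so they decay at a rate given by the continued fraction `decay`. Combined
with indifference at the right border, this bounds `n` times the load by `deviationFactor`
(`IsBorderSystem.load_le_of_le_border`), and the polynomials `ρ_n` are this continued fraction
written out. -/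

/-! ### Distance differences between neighbouring facilities. -/

/-- Distance of the client at `b` to the `k`-th facility minus her distance to the next one. -/
def distGap (t : ℕ → ℝ) (k : ℕ) (b : ℝ) : ℝ := |b - t k| - |b - t (k + 1)|

lemma distGap_mono {t : ℕ → ℝ} (ht : Monotone t) (k : ℕ) : Monotone (distGap t k) := by
  intro x y hxy
  have h := ht (Nat.le_succ k)
  simp only [distGap, Nat.succ_eq_add_one] at *
  cases abs_cases (x - t k) <;> cases abs_cases (y - t k) <;>
    cases abs_cases (x - t (k + 1)) <;> cases abs_cases (y - t (k + 1)) <;> linarith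

lemma distGap_nonpos {t : ℕ → ℝ} {k : ℕ} {b : ℝ} (ht : t k ≤ t (k + 1))
    (hb : 2 * b ≤ t k + t (k + 1)) : distGap t k b ≤ 0 := by
  unfold distGap
  cases abs_cases (b - t k) <;> cases abs_cases (b - t (k + 1)) <;> linarith

lemma distGap_nonneg {t : ℕ → ℝ} {k : ℕ} {b : ℝ} (ht : t k ≤ t (k + 1))
    (hb : t k + t (k + 1) ≤ 2 * b) : 0 ≤ distGap t k b := by
  unfold distGap
  cases abs_cases (b - t k) <;> cases abs_cases (b - t (k + 1)) <;> linarith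

lemma abs_distGap_le {t : ℕ → ℝ} (ht : Monotone t) (k : ℕ) (b : ℝ) :
    |distGap t k b| ≤ t (k + 1) - t k := by
  have h := ht (Nat.le_succ k)
  simp only [distGap, Nat.succ_eq_add_one] at *
  rw [abs_le]
  constructor <;> cases abs_cases (b - t k) <;> cases abs_cases (b - t (k + 1)) <;> linarith

/-! ### Border systems: existence by shooting, and monotonicity. -/

/-- Borders `0 = β 0, …, β n = 1` at which the clients are indifferent between the two
neighbouring facilities, where the facilities are located at `t 0 ≤ … ≤ t (n - 1)`. -/
structure IsBorderSystem (α : ℝ) (n : ℕ) (t β : ℕ → ℝ) : Prop where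
  zero : β 0 = 0
  last : β n = 1
  indifferent : ∀ k, k + 1 < n →
    α * ((β (k + 2) - β (k + 1)) - (β (k + 1) - β k)) = (1 - α) * distGap t k (β (k + 1))

/-- The border and the load after `k` steps when the first facility has load `b`. -/
noncomputable def shoot (α : ℝ) (t : ℕ → ℝ) (b : ℝ) : ℕ → ℝ × ℝ
  | 0 => (0, b)
  | k + 1 =>
    let p := shoot α t b k
    (p.1 + p.2, p.2 + (1 - α) / α * distGap t k (p.1 + p.2))

lemma continuous_shoot (α : ℝ) (t : ℕ → ℝ) (k : ℕ) : Continuous fun b => shoot α t b k := by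
  induction k with
  | zero => simp only [shoot]; fun_prop
  | succ k ih =>
    have h1 := ih.fst
    have h2 := ih.snd
    simp only [shoot, distGap]
    fun_prop

lemma abs_shoot_load_sub_le {α : ℝ} (hα : 0 < α) (hα1 : α ≤ 1) {t : ℕ → ℝ} (ht : Monotone t)
    (b : ℝ) (k : ℕ) : |(shoot α t b k).2 - b| ≤ (1 - α) / α * (t k - t 0) := by
  induction k with
  | zero => simp [shoot]
  | succ k ih =>
    simp only [shoot]
    set g := distGap t k ((shoot α t b k).1 + (shoot α t b k).2)
    have hg : |(1 - α) / α * g| ≤ (1 - α) / α * (t (k + 1) - t k) := by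
      rw [abs_mul, abs_of_nonneg (div_nonneg (by linarith) hα.le)]
      exact mul_le_mul_of_nonneg_left (abs_distGap_le ht k _) (div_nonneg (by linarith) hα.le)
    rw [abs_le] at *
    constructor <;> linarith [ih.1, ih.2, hg.1, hg.2]

/-- Borders exist for every increasing sequence of locations. -/
lemma exists_isBorderSystem {α : ℝ} (hα : 0 < α) (hα1 : α ≤ 1) {n : ℕ} (hn : 0 < n) {t : ℕ → ℝ}
    (ht : Monotone t) : ∃ β, IsBorderSystem α n t β := by
  have hc : 0 ≤ (1 - α) / α := div_nonneg (by linarith) hα.le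
  have hstep : ∀ b k, (shoot α t b (k + 1)).1 = (shoot α t b k).1 + (shoot α t b k).2 :=
    fun _ _ => rfl
  have hload : ∀ b k, k ≤ n → |(shoot α t b k).2 - b| ≤ (1 - α) / α * (t n - t 0) := by
    intro b k hk
    exact (abs_shoot_load_sub_le hα hα1 ht b k).trans
      (mul_le_mul_of_nonneg_left (by linarith [ht hk]) hc)
  -- All loads stay within `M` of the first one: first load `-M` makes every load nonpositive, and
  -- `1 + M` makes every load at least 1. The last border therefore takes the value 1 in between.
  set M := (1 - α) / α * (t n - t 0) with hM
  have hlow : (shoot α t (-M) n).1 ≤ 1 := by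
    have : ∀ k ≤ n, (shoot α t (-M) k).1 ≤ 0 := by
      intro k
      induction k with
      | zero => intro _; simp [shoot]
      | succ k ih =>
        intro hk
        rw [hstep]
        linarith [ih (by omega), (abs_le.1 (hload (-M) k (by omega))).2]
    linarith [this n le_rfl]
  have hhigh : 1 ≤ (shoot α t (1 + M) n).1 := by
    have : ∀ k ≤ n, (k : ℝ) ≤ (shoot α t (1 + M) k).1 := by
      intro k
      induction k with
      | zero => intro _; simp [shoot]
      | succ k ih =>
        intro hk
        rw [hstep]
        push_cast
        linarith [ih (by omega), (abs_le.1 (hload (1 + M) k (by omega))).1]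
    have h1 : (1 : ℝ) ≤ n := by exact_mod_cast hn
    linarith [this n le_rfl]
  obtain ⟨b, hb⟩ := mem_range_of_exists_le_of_exists_ge (continuous_shoot α t n).fst
    ⟨_, hlow⟩ ⟨_, hhigh⟩
  refine ⟨fun k => (shoot α t b k).1, rfl, hb, fun k _ => ?_⟩
  simp only [shoot]
  field_simp
  ring

/-- A negative load at a border left of its facility makes the next load negative as well, and so
on, which the last border 1 forbids. At a border right of its facility, the load is at least the
previous one, which is nonnegative by induction. -/
lemma IsBorderSystem.monotoneOn {α : ℝ} (hα : 0 < α) (hα1 : α ≤ 1) {n : ℕ} {t β : ℕ → ℝ}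
    (ht : Monotone t) (ht0 : 0 ≤ t 0) (ht1 : ∀ k, t k ≤ 1) (h : IsBorderSystem α n t β) :
    ∀ k < n, β k ≤ β (k + 1) := by
  have hend : ∀ m k, k + m + 1 = n → β k ≤ t k → β k ≤ β (k + 1) := by
    intro m
    induction m with
    | zero =>
      rintro k rfl hk
      have := h.last
      simp only [add_zero] at this
      linarith [ht1 k]
    | succ m ih =>
      intro k hk hb
      by_contra! hlt
      have h1 := h.indifferent k (by omega)
      have h2 := ht (Nat.le_succ k)
      simp only [Nat.succ_eq_add_one] at h2
      have h3 : distGap t k (β (k + 1)) ≤ 0 := distGap_nonpos h2 (by linarith)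
      have h4 := mul_nonneg (sub_nonneg.2 hα1) (neg_nonneg.2 h3)
      have h5 : β (k + 2) < β (k + 1) := by
        by_contra! h6
        have := mul_pos hα (show 0 < β (k + 2) - β (k + 1) - (β (k + 1) - β k) by linarith)
        linarith
      have h6 := ih (k + 1) (by omega) (by linarith)
      have : k + 1 + 1 = k + 2 := rfl
      rw [this] at h6
      linarith
  intro k
  induction k with
  | zero => intro hk; exact hend (n - 1) 0 (by omega) (by rw [h.zero]; exact ht0)
  | succ k ih =>
    intro hk
    by_cases hb : β (k + 1) ≤ t (k + 1)
    · exact hend (n - 1 - (k + 1)) (k + 1) (by omega) hb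
    · push Not at hb
      have h2 := ht (Nat.le_succ k)
      simp only [Nat.succ_eq_add_one] at h2
      have h1 := h.indifferent k hk
      have h3 : 0 ≤ distGap t k (β (k + 1)) := distGap_nonneg h2 (by linarith)
      have h4 := mul_nonneg (sub_nonneg.2 hα1) h3
      have h5 := ih (by omega)
      by_contra! h6
      have h7 : β (k + 2) < β (k + 1) := h6
      have := mul_pos hα (show 0 < (β (k + 1) - β k) - (β (k + 2) - β (k + 1)) by linarith)
      linarith

/-! ### From borders to client equilibria. -/

/-- A single client has measure zero, so her deviation changes no load. -/
lemma ClientMap.load_update {n : ℕ} (g : ClientMap n) (z : unitInterval) (i j : Fin n) :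
    ClientMap.load (Function.update g z j) i = g.load i := by
  unfold ClientMap.load
  refine measureReal_congr ?_
  have : ∀ᵐ x ∂(volume : Measure unitInterval), x ≠ z := by
    simp [ae_iff]
  filter_upwards [this] with x hx
  show ((Function.update g z j x = i) = (g x = i))
  rw [Function.update_of_ne hx]

lemma ClientMap.isClientEquilibrium_iff {n : ℕ} {α : ℝ} {s : Placement n} {g : ClientMap n} :
    g.IsClientEquilibrium α s ↔ ∀ (z : unitInterval) (j : Fin n),
      (1 - α) * |(s (g z) : ℝ) - (z : ℝ)| + α * g.load (g z) ≤
        (1 - α) * |(s j : ℝ) - (z : ℝ)| + α * g.load j := by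
  simp [ClientMap.IsClientEquilibrium, ClientMap.cost, ClientMap.load_update]

lemma le_of_forall_le_succ {n : ℕ} {β : ℕ → ℝ} (hβ : ∀ k < n, β k ≤ β (k + 1)) {i j : ℕ}
    (hij : i ≤ j) (hj : j ≤ n) : β i ≤ β j := by
  induction j, hij using Nat.le_induction with
  | base => exact le_rfl
  | succ k _ ih => exact (ih (by omega)).trans (hβ k (by omega))

/-- Clients can be distributed to the intervals between consecutive borders. -/
lemma exists_monotone_index {n : ℕ} (hn : 0 < n) {β : ℕ → ℝ} (h0 : β 0 = 0) (h1 : β n = 1) :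
    ∃ κ : unitInterval → Fin n, Monotone κ ∧
      ∀ z, β (κ z) ≤ (z : ℝ) ∧ (z : ℝ) ≤ β (κ z + 1) := by
  have hex : ∀ z : unitInterval, ∃ k, (z : ℝ) ≤ β (k + 1) := fun z =>
    ⟨n - 1, by rw [Nat.sub_add_cancel hn, h1]; exact z.2.2⟩
  classical
  have hlt : ∀ z, Nat.find (hex z) < n := fun z => by
    have : Nat.find (hex z) ≤ n - 1 := Nat.find_min' _ (by
      rw [Nat.sub_add_cancel hn, h1]; exact z.2.2)
    omega
  -- Each client takes the first interval whose right end she does not exceed, which makes the index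
  -- monotone in `z`.
  refine ⟨fun z => ⟨Nat.find (hex z), hlt z⟩, ?_, fun z => ⟨?_, Nat.find_spec (hex z)⟩⟩
  · intro y z hyz
    exact Nat.find_min' _ ((Subtype.coe_le_coe.2 hyz).trans (Nat.find_spec (hex z)))
  · show β (Nat.find (hex z)) ≤ z
    rcases Nat.eq_zero_or_pos (Nat.find (hex z)) with h | h
    · rw [h, h0]; exact z.2.1
    · have := Nat.find_min (hex z) (Nat.sub_lt h one_pos)
      rw [show Nat.find (hex z) - 1 + 1 = Nat.find (hex z) by omega] at this
      exact (not_le.1 this).le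

lemma volume_real_fiber {n : ℕ} {β : ℕ → ℝ} (h0 : β 0 = 0) (h1 : β n = 1)
    (hβ : ∀ k < n, β k ≤ β (k + 1)) {κ : unitInterval → Fin n}
    (hκ : ∀ z, β (κ z) ≤ (z : ℝ) ∧ (z : ℝ) ≤ β (κ z + 1)) (k : Fin n) :
    (volume : Measure unitInterval).real {z | κ z = k} = β (k + 1) - β k := by
  have hmem : ∀ j ≤ n, β j ∈ unitInterval := fun j hj =>
    ⟨h0 ▸ le_of_forall_le_succ hβ (Nat.zero_le j) hj, h1 ▸ le_of_forall_le_succ hβ hj le_rfl⟩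
  set x : unitInterval := ⟨β k, hmem k k.2.le⟩
  set y : unitInterval := ⟨β (k + 1), hmem (k + 1) k.2⟩
  have hsub : {z | κ z = k} ⊆ Set.Icc x y := by
    rintro z rfl
    exact hκ z
  have hsup : Set.Ioo x y ⊆ {z | κ z = k} := by
    intro z hz
    have hz1 : β k < z := hz.1
    have hz2 : (z : ℝ) < β (k + 1) := hz.2
    by_contra hne
    rcases lt_or_gt_of_ne (fun h => hne (Fin.ext h) : (κ z : ℕ) ≠ k) with h | h
    · linarith [(hκ z).2, le_of_forall_le_succ hβ (show (κ z : ℕ) + 1 ≤ k from h) k.2.le]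
    · linarith [(hκ z).1, le_of_forall_le_succ hβ (show (k : ℕ) + 1 ≤ κ z from h) (κ z).2.le]
  have hvol : volume {z | κ z = k} = ENNReal.ofReal (β (k + 1) - β k) := by
    apply le_antisymm
    · exact (measure_mono hsub).trans_eq (unitInterval.volume_Icc x y)
    · exact (unitInterval.volume_Ioo x y).symm.le.trans (measure_mono hsup)
  rw [Measure.real, hvol, ENNReal.toReal_ofReal (sub_nonneg.2 (hβ k k.2))]

/-- The client between the `k`-th and the `k + 1`-st border has least cost at the `k`-th
facility. -/
lemma IsBorderSystem.cost_le {α : ℝ} (hα1 : α ≤ 1) {n : ℕ} {t β : ℕ → ℝ} (ht : Monotone t)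
    (h : IsBorderSystem α n t β) (hβ : ∀ k < n, β k ≤ β (k + 1)) {z : ℝ} {k j : ℕ} (hk : k < n)
    (hj : j < n) (hz1 : β k ≤ z) (hz2 : z ≤ β (k + 1)) :
    (1 - α) * |t k - z| + α * (β (k + 1) - β k) ≤
      (1 - α) * |t j - z| + α * (β (j + 1) - β j) := by
  -- Indifference at the border turns the cost difference of neighbours into an increment of the
  -- monotone `distGap`; hence costs do not decrease when moving away from `k` in either direction.
  have hdiff : ∀ m, m + 1 < n →
      ((1 - α) * |t (m + 1) - z| + α * (β (m + 1 + 1) - β (m + 1))) -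
        ((1 - α) * |t m - z| + α * (β (m + 1) - β m)) =
      (1 - α) * (distGap t m (β (m + 1)) - distGap t m z) := by
    intro m hm
    have := h.indifferent m hm
    simp only [distGap, abs_sub_comm (t _)] at *
    linarith
  rcases le_total k j with hkj | hkj
  · induction j, hkj using Nat.le_induction with
    | base => exact le_rfl
    | succ m hm ih =>
      have h1 := ih (by omega)
      have h2 := hdiff m hj
      have h3 := mul_nonneg (sub_nonneg.2 hα1) (sub_nonneg.2 (distGap_mono ht m
        (hz2.trans (le_of_forall_le_succ hβ (show k + 1 ≤ m + 1 by omega) hj.le))))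
      linarith
  · have key : ∀ m, j ≤ m → m ≤ k → (1 - α) * |t m - z| + α * (β (m + 1) - β m) ≤
        (1 - α) * |t j - z| + α * (β (j + 1) - β j) := by
      intro m hm
      induction m, hm using Nat.le_induction with
      | base => exact fun _ => le_rfl
      | succ m hm ih =>
        intro hmk
        have h1 := ih (by omega)
        have h2 := hdiff m (by omega)
        have h3 := mul_nonneg (sub_nonneg.2 hα1) (sub_nonneg.2 (distGap_mono ht m
          ((le_of_forall_le_succ hβ hmk hk.le).trans hz1)))
        linarith
    exact key k hkj le_rfl

/-- Borders at which the neighbouring facilities are equally good define a proper client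
equilibrium. -/
lemma IsBorderSystem.exists_clientMap {α : ℝ} (hα1 : α ≤ 1) {n : ℕ} (hn : 0 < n) {s : Placement n}
    {σ : Equiv.Perm (Fin n)} {t β : ℕ → ℝ} (ht : Monotone t) (hts : ∀ k : Fin n, t k = s (σ k))
    (h : IsBorderSystem α n t β) (hβ : ∀ k < n, β k ≤ β (k + 1)) :
    ∃ g : ClientMap n, g.IsMeasurableMap ∧ g.IsClientEquilibrium α s ∧ g.IsProper s ∧
      ∀ k : Fin n, g.load (σ k) = β (k + 1) - β k := by
  obtain ⟨κ, hκm, hκ⟩ := exists_monotone_index hn h.zero h.last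
  have hfib : ∀ k, {z | σ (κ z) = σ k} = {z | κ z = k} := fun k => by
    ext z; simp
  have hload : ∀ k : Fin n, ClientMap.load (fun z => σ (κ z)) (σ k) = β (k + 1) - β k := by
    intro k
    rw [ClientMap.load, hfib, volume_real_fiber h.zero h.last hβ hκ]
  refine ⟨fun z => σ (κ z), ?_, ?_, ?_, hload⟩
  · intro i
    obtain ⟨k, rfl⟩ := σ.surjective i
    refine ⟨{{z | κ z = k}}, Set.finite_singleton _, Set.pairwiseDisjoint_singleton _ _, ?_, ?_⟩
    · rintro A rfl
      exact Set.ordConnected_singleton.preimage_mono hκm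
    · rw [Set.sUnion_singleton, hfib]
  · rw [ClientMap.isClientEquilibrium_iff]
    intro z j
    obtain ⟨k, rfl⟩ := σ.surjective j
    rw [hload, hload, ← hts, ← hts]
    exact h.cost_le hα1 ht hβ (κ z).2 k.2 (hκ z).1 (hκ z).2
  · refine ⟨σ, fun k => β k, ?_, ?_, h.zero, h.last, ?_⟩
    · intro j k hjk
      rw [← Subtype.coe_le_coe]
      simp only [← hts]
      exact ht hjk
    · intro j k hjk
      exact le_of_forall_le_succ hβ hjk (Nat.lt_succ_iff.1 k.2)
    · intro z k hk
      rw [← σ.injective hk]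
      exact hκ z

/-! ### Uniqueness of equilibrium loads. -/

lemma ClientMap.IsMeasurableMap.measurable {n : ℕ} {g : ClientMap n} (hg : g.IsMeasurableMap) :
    Measurable g := by
  refine measurable_to_countable' fun i => ?_
  obtain ⟨J, hJ, -, hord, heq⟩ := hg i
  have : g ⁻¹' {i} = ⋃₀ J := heq
  rw [this]
  exact MeasurableSet.sUnion hJ.countable fun A hA => (hord A hA).measurableSet

lemma ClientMap.integral_comp {n : ℕ} {g : ClientMap n} (hg : Measurable g) (F : Fin n → ℝ) :
    Integrable (fun z => F (g z)) ∧ ∫ z, F (g z) = ∑ i, g.load i * F i := by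
  have hF : Integrable F (volume.map g) := Integrable.of_finite
  refine ⟨hF.comp_measurable hg, ?_⟩
  rw [← integral_map hg.aemeasurable (measurable_of_finite F).aestronglyMeasurable,
    integral_fintype hF]
  refine Finset.sum_congr rfl fun i _ => ?_
  rw [map_measureReal_apply hg (measurableSet_singleton i), smul_eq_mul]
  rfl

/-- All client equilibria for one location vector have the same loads. -/
lemma ClientMap.IsClientEquilibrium.load_eq {n : ℕ} {α : ℝ} (hα : 0 < α) {s : Placement n}
    {g h : ClientMap n} (hgm : g.IsMeasurableMap) (hhm : h.IsMeasurableMap)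
    (hg : g.IsClientEquilibrium α s) (hh : h.IsClientEquilibrium α s) (i : Fin n) :
    g.load i = h.load i := by
  rw [ClientMap.isClientEquilibrium_iff] at hg hh
  set F : Fin n → ℝ := fun i => g.load i - h.load i
  -- The distance terms cancel when the two equilibrium inequalities for the client `z` are added.
  -- Integrating over `z` then yields a sum of squares that is at most 0.
  have hpt : ∀ z, F (g z) ≤ F (h z) := by
    intro z
    have h1 := hg z (h z)
    have h2 := hh z (g z)
    have h3 : α * F (g z) ≤ α * F (h z) := by simp only [F]; linarith
    exact le_of_mul_le_mul_left h3 hα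
  obtain ⟨hig, heg⟩ := ClientMap.integral_comp hgm.measurable F
  obtain ⟨hih, heh⟩ := ClientMap.integral_comp hhm.measurable F
  have hle := integral_mono hig hih hpt
  rw [heg, heh, ← sub_nonpos, ← Finset.sum_sub_distrib] at hle
  have hsq : ∑ i, F i ^ 2 ≤ 0 := by
    refine (Finset.sum_congr rfl fun i _ => ?_).trans_le hle
    simp only [F]; ring
  have hz := (Finset.sum_eq_zero_iff_of_nonneg fun i _ => sq_nonneg (F i)).1
    (hsq.antisymm (Finset.sum_nonneg fun i _ => sq_nonneg (F i))) i (Finset.mem_univ i)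
  exact sub_eq_zero.1 (pow_eq_zero_iff two_ne_zero |>.1 hz)

/-! ### Decay of border displacements and the load bound. -/

/-- Factor, up to `α`, by which the displacement of the borders from the uniform ones decays from
border to border, when `m + 1` facilities are left. -/
noncomputable def decay (α : ℝ) : ℕ → ℝ
  | 0 => 0
  | m + 1 => α ^ 2 / (2 - decay α m)

lemma decay_mem {α : ℝ} (h0 : 0 ≤ α) (h1 : α ≤ 1) (m : ℕ) : 0 ≤ decay α m ∧ decay α m ≤ 1 := by
  induction m with
  | zero => simp [decay]
  | succ m ih =>
    have h2 : 0 < 2 - decay α m := by linarith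
    refine ⟨div_nonneg (sq_nonneg α) h2.le, ?_⟩
    rw [decay, div_le_one h2]
    nlinarith

lemma decay_mono {α : ℝ} (h0 : 0 ≤ α) (h1 : α ≤ 1) : Monotone (decay α) := by
  refine monotone_nat_of_le_succ fun m => ?_
  induction m with
  | zero => exact (decay_mem h0 h1 1).1
  | succ m ih =>
    rw [decay, decay]
    have := (decay_mem h0 h1 (m + 1)).2
    exact div_le_div_of_nonneg_left (sq_nonneg α) (by linarith) (by linarith)

/-- The bound for the load of a facility that leaves the uniform placement, times `n`. -/
noncomputable def deviationFactor (n : ℕ) (α : ℝ) : ℝ :=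
  1 + (1 - α) / (2 * (1 + α - decay α (n - 2)))

lemma one_le_deviationFactor {α : ℝ} (h0 : 0 ≤ α) (h1 : α ≤ 1) (n : ℕ) :
    1 ≤ deviationFactor n α := by
  have := (decay_mem h0 h1 (n - 2)).2
  exact le_add_of_nonneg_right (div_nonneg (by linarith) (by linarith))

/-- Downward induction from `e n = 0`. A border displaced to one side favours the facility beyond
it, so displacements keep their sign and shrink towards `n`. While a displacement is between 0 and
`1 / (2 * n)`, the border lies between its two facilities and `distGap` is exactly `2 * e`, which
gives the linear recursion behind `decay`. -/
lemma IsBorderSystem.decay_right {α : ℝ} (hα : 0 < α) (hα1 : α ≤ 1) {n d : ℕ} (hn : 0 < n)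
    {t β : ℕ → ℝ} (ht : Monotone t) (h : IsBorderSystem α n t β)
    (hr : ∀ k, d < k → k < n → t k = (2 * k + 1) / (2 * n)) {e : ℕ → ℝ}
    (he : ∀ k, e k = β k - k / n) (m : ℕ) : ∀ k, k + m + 1 = n → d < k →
    ((0 ≤ e (k + 1) ∧ e (k + 1) ≤ e k) ∨ (e k ≤ e (k + 1) ∧ e (k + 1) ≤ 0)) ∧
      (0 ≤ e k → e k ≤ 1 / (2 * n) → α * e (k + 1) ≤ decay α m * e k) := by
  have hn' : (0 : ℝ) < n := by exact_mod_cast hn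
  induction m with
  | zero =>
    intro k hk _
    have h1 : e (k + 1) = 0 := by
      have : k + 1 = n := by omega
      rw [he, this, h.last, div_self hn'.ne', sub_self]
    rw [h1]
    refine ⟨?_, fun _ _ => by simp [decay]⟩
    rcases le_total 0 (e k) with h2 | h2
    · exact Or.inl ⟨le_rfl, h2⟩
    · exact Or.inr ⟨h2, le_rfl⟩
  | succ m ih =>
    intro k hk hdk
    obtain ⟨hs, hd⟩ := ih (k + 1) (by omega) (by omega)
    have hb := h.indifferent k (by omega)
    have htk := ht (Nat.le_succ k)
    have h1 := hr k hdk (by omega)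
    have h2 := hr (k + 1) (by omega) (by omega)
    have hc : 0 ≤ 1 - α := by linarith
    have e0 := he k
    have e1 := he (k + 1)
    have e2 := he (k + 2)
    push_cast at h1 h2 e1 e2
    have hk1 : t k = (k + 1) / n - 1 / (2 * n) := by rw [h1]; field_simp; ring
    have hk2 : t (k + 1) = (k + 1) / n + 1 / (2 * n) := by rw [h2]; field_simp
    have q0 : (k : ℝ) / n = (k + 1) / n - 1 / n := by ring
    have q2 : ((k : ℝ) + 2) / n = (k + 1) / n + 1 / n := by ring
    have hpos : 0 < 1 / (2 * (n : ℝ)) := by positivity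
    have hrec : α * (e (k + 2) - e (k + 1)) = α * (e (k + 1) - e k) +
        (1 - α) * distGap t k (β (k + 1)) := by
      rw [← hb, e0, e1, e2, q0, q2]; ring
    have hsign : (0 ≤ e (k + 1) ∧ e (k + 1) ≤ e k) ∨ (e k ≤ e (k + 1) ∧ e (k + 1) ≤ 0) := by
      rcases hs with ⟨h3, h4⟩ | ⟨h3, h4⟩
      · have h5 : 0 ≤ e (k + 1) := h3.trans h4
        have h6 : 0 ≤ distGap t k (β (k + 1)) := distGap_nonneg htk (by linarith)
        have h7 := mul_nonneg hc h6
        refine Or.inl ⟨h5, ?_⟩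
        by_contra! h8
        have h9 := mul_pos hα (sub_pos.2 h8)
        have h10 := mul_nonneg hα.le (sub_nonneg.2 h4)
        have : e (k + 1 + 1) = e (k + 2) := rfl
        rw [this] at h10
        linarith
      · have h5 : e (k + 1) ≤ 0 := h3.trans h4
        have h6 : distGap t k (β (k + 1)) ≤ 0 := distGap_nonpos htk (by linarith)
        have h7 := mul_nonneg hc (neg_nonneg.2 h6)
        refine Or.inr ⟨?_, h5⟩
        by_contra! h8
        have h9 := mul_pos hα (sub_pos.2 h8)
        have h10 := mul_nonneg hα.le (sub_nonneg.2 h3)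
        have : e (k + 1 + 1) = e (k + 2) := rfl
        rw [this] at h10
        linarith
    refine ⟨hsign, fun h3 h4 => ?_⟩
    have h5 : 0 ≤ e (k + 1) ∧ e (k + 1) ≤ e k := by
      rcases hsign with h5 | h5
      · exact h5
      · have : e k = 0 := by linarith
        have : e (k + 1) = 0 := by linarith
        constructor <;> linarith
    have h6 : distGap t k (β (k + 1)) = 2 * e (k + 1) := by
      rw [distGap, abs_of_nonneg (by linarith), abs_of_nonpos (by linarith)]
      linarith
    have h7 := hd h5.1 (h5.2.trans h4)
    have h8 : e (k + 1 + 1) = e (k + 2) := rfl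
    rw [h8] at h7
    rw [h6] at hrec
    have h9 : 0 < 2 - decay α m := by linarith [(decay_mem hα.le hα1 m).2]
    rw [decay, div_mul_eq_mul_div, le_div_iff₀ h9]
    have h10 : e (k + 1) * (2 - decay α m) ≤ α * e k := by linarith
    calc α * e (k + 1) * (2 - decay α m) = α * (e (k + 1) * (2 - decay α m)) := by ring
      _ ≤ α * (α * e k) := mul_le_mul_of_nonneg_left h10 hα.le
      _ = α ^ 2 * e k := by ring

/-- Bound for the load of the facility `d` if the facilities to its right are placed uniformly and
those to its left serve at least their share of the market. -/
lemma IsBorderSystem.load_le_of_le_border {α : ℝ} (hα : 0 < α) (hα1 : α ≤ 1) {n d : ℕ} (hd : d < n)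
    {t β : ℕ → ℝ} (ht : Monotone t) (h : IsBorderSystem α n t β)
    (hr : ∀ k, d < k → k < n → t k = (2 * k + 1) / (2 * n)) (hβ : (d : ℝ) / n ≤ β d) :
    n * (β (d + 1) - β d) ≤ deviationFactor n α := by
  have hn : 0 < n := by omega
  have hn' : (0 : ℝ) < n := by exact_mod_cast hn
  have hF := one_le_deviationFactor hα.le hα1 n
  suffices hs : β (d + 1) - β d ≤ 1 / n + (deviationFactor n α - 1) / n by
    calc n * (β (d + 1) - β d) ≤ n * (1 / n + (deviationFactor n α - 1) / n) :=
          mul_le_mul_of_nonneg_left hs hn'.le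
      _ = deviationFactor n α := by field_simp; ring
  have hF' : 0 ≤ (deviationFactor n α - 1) / n := div_nonneg (by linarith) hn'.le
  have q1 : ((d : ℝ) + 1) / n = d / n + 1 / n := by ring
  by_cases hv : β (d + 1) ≤ (d + 1) / n
  · linarith
  push Not at hv
  have hdn : d + 1 < n := by
    by_contra hcon
    have hdn : d + 1 = n := by omega
    have hdn' : (d : ℝ) + 1 = n := by exact_mod_cast hdn
    rw [hdn, h.last, hdn', div_self hn'.ne'] at hv
    exact lt_irrefl _ hv
  have hc : 0 ≤ 1 - α := by linarith
  obtain ⟨hs, hdec⟩ := h.decay_right hα hα1 hn ht hr (fun k => rfl) (n - d - 2) (d + 1)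
    (by omega) (by omega)
  push_cast at hs hdec
  have hb := h.indifferent d hdn
  have htd := hr (d + 1) (by omega) hdn
  push_cast at htd
  have htd' : t (d + 1) = (d + 1) / n + 1 / (2 * n) := by rw [htd]; field_simp
  have hx := ht (Nat.le_succ d)
  simp only [Nat.succ_eq_add_one] at hx
  have q2 : ((d : ℝ) + 1 + 1) / n = (d + 1) / n + 1 / n := by ring
  rw [show d + 1 + 1 = d + 2 from rfl, q2] at hs hdec
  have hnext : β (d + 2) - β (d + 1) ≤ 1 / n := by
    rcases hs with h1 | h1 <;> linarith
  by_cases hv2 : β (d + 1) ≤ t (d + 1)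
  · have h1 := hdec (by linarith) (by linarith)
    -- Discarding the distance to the deviator itself corresponds to placing it on its own right
    -- border.
    have h2 : -(t (d + 1) - β (d + 1)) ≤ distGap t d (β (d + 1)) := by
      rw [distGap, abs_of_nonpos (by linarith : β (d + 1) - t (d + 1) ≤ 0)]
      linarith [abs_nonneg (β (d + 1) - t d)]
    have h3 := mul_le_mul_of_nonneg_left h2 hc
    -- The bound is weakest for `d = 0`, when the most facilities remain to the right.
    have hm := decay_mono hα.le hα1 (show n - d - 2 ≤ n - 2 by omega)
    set w := decay α (n - d - 2)
    set W := decay α (n - 2) with hW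
    have hW1 := (decay_mem hα.le hα1 (n - 2)).2
    have hv0 : 0 < β (d + 1) - (d + 1) / n := by linarith
    have h4 : α * (β (d + 2) - ((d + 1) / n + 1 / n)) ≤ W * (β (d + 1) - (d + 1) / n) :=
      h1.trans (mul_le_mul_of_nonneg_right hm hv0.le)
    have h5 : (1 - W) * (β (d + 1) - β d - 1 / n) ≤ (1 - W) * (β (d + 1) - (d + 1) / n) :=
      mul_le_mul_of_nonneg_left (by linarith) (by linarith)
    have hpos : 0 < 1 + α - W := by linarith
    -- Indifference at the right border and `h4` bound `α` times the excess load by `(1 - α) / (2 *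
    -- n)` minus `1 - W` times the displacement; `h5` replaces the displacement by the excess load.
    have h6 : (1 + α - W) * (β (d + 1) - β d - 1 / n) ≤ (1 - α) * (1 / (2 * n)) := by
      rw [htd'] at h3
      linarith
    have h7 : β (d + 1) - β d - 1 / n ≤ (1 - α) * (1 / (2 * n)) / (1 + α - W) := by
      rw [le_div_iff₀ hpos]; linarith
    have h8 : (deviationFactor n α - 1) / n = (1 - α) * (1 / (2 * n)) / (1 + α - W) := by
      rw [deviationFactor, ← hW]; field_simp; ring
    linarith
  · push Not at hv2
    have h2 : 0 ≤ distGap t d (β (d + 1)) := distGap_nonneg hx (by linarith)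
    have h3 := mul_nonneg hc h2
    by_contra! h4
    have := mul_pos hα (show 0 < (β (d + 1) - β d) - (β (d + 2) - β (d + 1)) by linarith)
    linarith

/-- Bound for the load of the facility `d` if the facilities to its right are placed uniformly and
those to its left are not further left than in the uniform placement. -/
lemma IsBorderSystem.load_le_of_uniform_right {α : ℝ} (hα : 0 < α) (hα1 : α ≤ 1) {n d : ℕ}
    (hd : d < n) {t β : ℕ → ℝ} (ht : Monotone t) (h : IsBorderSystem α n t β)
    (hr : ∀ k, d < k → k < n → t k = (2 * k + 1) / (2 * n))
    (hl : ∀ k < d, 2 * (((k : ℝ) + 1) / n) ≤ t k + t (k + 1)) :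
    n * (β (d + 1) - β d) ≤ deviationFactor n α := by
  by_cases hβ : (d : ℝ) / n ≤ β d
  · exact h.load_le_of_le_border hα hα1 hd ht hr hβ
  push Not at hβ
  have hn' : (0 : ℝ) < n := by exact_mod_cast (show 0 < n by omega)
  refine le_trans ?_ (one_le_deviationFactor hα.le hα1 n)
  by_contra! hcon
  have hload : 1 / n < β (d + 1) - β d := by
    rw [div_lt_iff₀ hn']; linarith
  -- A border left of its uniform position is left of the midpoint of its facilities, so the load on
  -- its left is at least the one on its right. Thus all loads left of `d` exceed `1 / n` too, which
  -- pushes `β 0` below 0.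
  have key : ∀ m k, k + m = d → β k < k / n ∧ 1 / n < β (k + 1) - β k := by
    intro m
    induction m with
    | zero => rintro k rfl; exact ⟨hβ, hload⟩
    | succ m ih =>
      intro k hk
      obtain ⟨h1, h2⟩ := ih (k + 1) (by omega)
      push_cast at h1
      have h3 := h.indifferent k (by omega)
      have h4 := distGap_nonpos (b := β (k + 1)) (ht (Nat.le_succ k))
        (le_trans (by linarith) (hl k (by omega)))
      have h5 := mul_nonneg (sub_nonneg.2 hα1) (neg_nonneg.2 h4)
      rw [show k + 1 + 1 = k + 2 from rfl] at h2
      have h6 : β (k + 2) - β (k + 1) ≤ β (k + 1) - β k := by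
        by_contra! h6
        have := mul_pos hα (sub_pos.2 h6)
        linarith
      have q : ((k : ℝ) + 1) / n = k / n + 1 / n := by ring
      constructor <;> linarith
  have := (key d 0 (by omega)).1
  rw [h.zero] at this
  simp at this

/-- The mirror image of the market, which transfers bounds from deviations to the right to
deviations to the left. -/
lemma IsBorderSystem.reflect {α : ℝ} {n : ℕ} {t β : ℕ → ℝ} (h : IsBorderSystem α n t β) :
    IsBorderSystem α n (fun k => 1 - t (n - 1 - k)) (fun k => 1 - β (n - k)) := by
  refine ⟨by simp [h.last], by simp [h.zero], fun k hk => ?_⟩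
  obtain ⟨m, rfl⟩ : ∃ m, n = k + m + 2 := ⟨n - k - 2, by omega⟩
  have := h.indifferent m (by omega)
  have e1 : k + m + 2 - (k + 2) = m := by omega
  have e2 : k + m + 2 - (k + 1) = m + 1 := by omega
  have e3 : k + m + 2 - k = m + 2 := by omega
  have e4 : k + m + 2 - 1 - k = m + 1 := by omega
  have e5 : k + m + 2 - 1 - (k + 1) = m := by omega
  simp only [distGap, e1, e2, e3, e4, e5] at *
  rw [show 1 - β (m + 1) - (1 - t (m + 1)) = -(β (m + 1) - t (m + 1)) by ring,
    show 1 - β (m + 1) - (1 - t m) = -(β (m + 1) - t m) by ring, abs_neg, abs_neg]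
  linarith

lemma IsBorderSystem.load_le_of_uniform_left {α : ℝ} (hα : 0 < α) (hα1 : α ≤ 1) {n d : ℕ}
    (hd : d < n) {t β : ℕ → ℝ} (ht : Monotone t) (h : IsBorderSystem α n t β)
    (hl : ∀ k < d, t k = (2 * k + 1) / (2 * n))
    (hr : ∀ k, d ≤ k → k + 1 < n → t k + t (k + 1) ≤ 2 * (((k : ℝ) + 1) / n)) :
    n * (β (d + 1) - β d) ≤ deviationFactor n α := by
  have hn' : (0 : ℝ) < n := by exact_mod_cast (show 0 < n by omega)
  have hmono : Monotone fun k => 1 - t (n - 1 - k) := fun j k hjk =>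
    sub_le_sub_left (ht (by omega)) 1
  have := h.reflect.load_le_of_uniform_right (d := n - 1 - d) hα hα1 (by omega) hmono ?_ ?_
  · have e1 : n - (n - 1 - d + 1) = d := by omega
    have e2 : n - (n - 1 - d) = d + 1 := by omega
    simp only [e1, e2] at this
    convert this using 2
    ring
  · intro k hk hkn
    obtain ⟨m, rfl⟩ : ∃ m, n = k + m + 1 := ⟨n - k - 1, by omega⟩
    have e : k + m + 1 - 1 - k = m := by omega
    simp only [e]
    rw [hl m (by omega)]
    push_cast at hn' ⊢
    field_simp
    ring
  · intro k hk
    obtain ⟨m, rfl⟩ : ∃ m, n = k + m + 2 := ⟨n - k - 2, by omega⟩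
    have e4 : k + m + 2 - 1 - k = m + 1 := by omega
    have e5 : k + m + 2 - 1 - (k + 1) = m := by omega
    simp only [e4, e5]
    have h1 := hr m (by omega) (by omega)
    push_cast at hn' h1 ⊢
    have h2 : ((k : ℝ) + 1) / (k + m + 2) = 1 - (m + 1) / (k + m + 2) := by field_simp; ring
    linarith

/-! ### Sorted locations after one facility moves. -/

lemma coe_sOpt {n : ℕ} (k : Fin n) : (sOpt n k : ℝ) = (2 * (k : ℕ) + 1) / (2 * n) := by
  simp only [sOpt]
  ring

lemma strictMono_sOpt (n : ℕ) : StrictMono (sOpt n) := by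
  intro j k hjk
  have hn : (0 : ℝ) < n := by exact_mod_cast k.pos
  have h : ((j : ℕ) : ℝ) < (k : ℕ) := by exact_mod_cast hjk
  rw [← Subtype.coe_lt_coe, coe_sOpt, coe_sOpt]
  gcongr

/-- Sorting a strictly increasing vector after one entry has been changed keeps the order of the
other entries. -/
lemma sort_update_succAbove {N : ℕ} {A : Type*} [LinearOrder A] {s : Fin (N + 1) → A}
    (hs : StrictMono s) (i : Fin (N + 1)) (x : A) {σ : Equiv.Perm (Fin (N + 1))}
    (hσ : Monotone (fun k => Function.update s i x (σ k))) (j : Fin N) :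
    σ ((σ.symm i).succAbove j) = i.succAbove j := by
  have hne : ∀ j, σ ((σ.symm i).succAbove j) ≠ i := fun j h =>
    Fin.succAbove_ne (σ.symm i) j (by rw [Equiv.eq_symm_apply, h])
  -- Without the moved facility the order is strict, so ties with `x` are harmless; a strictly
  -- increasing enumeration is determined by its range.
  have hmono : StrictMono fun j => σ ((σ.symm i).succAbove j) := by
    intro j k hjk
    have hlt := (Fin.strictMono_succAbove (σ.symm i)) hjk
    have h := hσ hlt.le
    simp only [Function.update_of_ne (hne _)] at h
    exact lt_of_le_of_ne (hs.le_iff_le.1 h) (σ.injective.ne hlt.ne)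
  have hrange : Set.range (fun j => σ ((σ.symm i).succAbove j)) = Set.range i.succAbove := by
    rw [Fin.range_succAbove, Set.range_comp' σ, Fin.range_succAbove]
    ext y
    simp [Equiv.eq_symm_apply]
  exact congrFun ((hmono.range_inj (Fin.strictMono_succAbove i)).1 hrange) j

/-- Location of the facility with index `j` in the uniform placement of `n` facilities. -/
noncomputable def unif (n j : ℕ) : ℝ := (2 * j + 1) / (2 * n)

lemma unif_mono (n : ℕ) : Monotone (unif n) := by
  intro j k hjk
  unfold unif
  have : (j : ℝ) ≤ k := by exact_mod_cast hjk
  gcongr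

/-- The sorted locations after facility `i` left the uniform placement; it now is facility `d`. -/
structure IsDeviation (n i d : ℕ) (t : ℕ → ℝ) : Prop where
  mono : Monotone t
  lt : d < n
  left : ∀ k < d, t k = unif n (if k < i then k else k + 1)
  right : ∀ k, d < k → k < n → t k = unif n (if k ≤ i then k - 1 else k)

lemma isDeviation_of_sorted {n : ℕ} {i : Fin n} {x : unitInterval} {σ : Equiv.Perm (Fin n)}
    {t : ℕ → ℝ} (ht : Monotone t)
    (hts : ∀ k : Fin n, t k = Function.update (sOpt n) i x (σ k)) :
    IsDeviation n i (σ.symm i) t := by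
  obtain ⟨N, rfl⟩ : ∃ N, n = N + 1 := ⟨n - 1, by have := i.pos; omega⟩
  have hσ : Monotone (fun k => Function.update (sOpt (N + 1)) i x (σ k)) := by
    intro j k hjk
    rw [← Subtype.coe_le_coe]
    simp only [← hts]
    exact ht hjk
  set d := σ.symm i with hd
  have hj : ∀ j : Fin N, t (d.succAbove j) = unif (N + 1) (i.succAbove j) := by
    intro j
    rw [hts, sort_update_succAbove (strictMono_sOpt _) i x hσ,
      Function.update_of_ne (Fin.succAbove_ne i j), coe_sOpt, unif]
  refine ⟨ht, d.2, fun k hk => ?_, fun k hk hkn => ?_⟩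
  · have h := hj ⟨k, by omega⟩
    rw [Fin.succAbove_of_castSucc_lt d _ (by simpa [Fin.lt_def] using hk)] at h
    simp only [Fin.val_castSucc] at h
    rw [h]
    split_ifs with hki
    · rw [Fin.succAbove_of_castSucc_lt i _ (by simpa [Fin.lt_def] using hki)]
      rfl
    · rw [Fin.succAbove_of_le_castSucc i _ (by simpa [Fin.le_def] using hki)]
      rfl
  · have h := hj ⟨k - 1, by omega⟩
    rw [Fin.succAbove_of_le_castSucc d _ (by simp only [Fin.le_def, Fin.val_castSucc]; omega)] at h
    simp only [Fin.val_succ] at h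
    rw [show k - 1 + 1 = k by omega] at h
    rw [h]
    split_ifs with hki
    · rw [Fin.succAbove_of_castSucc_lt i _ (by simp only [Fin.lt_def, Fin.val_castSucc]; omega)]
      rfl
    · rw [Fin.succAbove_of_le_castSucc i _ (by simp only [Fin.le_def, Fin.val_castSucc]; omega)]
      simp only [Fin.val_succ]
      rw [show k - 1 + 1 = k by omega]

lemma unif_add_unif {n : ℕ} (k : ℕ) :
    unif n k + unif n (k + 1) = 2 * (((k : ℝ) + 1) / n) := by
  rcases Nat.eq_zero_or_pos n with rfl | hn
  · simp [unif]
  · simp only [unif]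
    push_cast
    field_simp
    ring

lemma IsBorderSystem.deviation_load_le {α : ℝ} (hα : 0 < α) (hα1 : α ≤ 1) {n i d : ℕ}
    {t β : ℕ → ℝ} (hi : i < n) (ht : IsDeviation n i d t) (h : IsBorderSystem α n t β) :
    n * (β (d + 1) - β d) ≤ deviationFactor n α := by
  have hu := unif_mono n
  -- A move to the right, in rank or within the same rank, leaves the facilities right of `d`
  -- uniform, and the overtaken ones each lose one rank, which puts rank `k` at place `k + 1`. The
  -- remaining case is the mirror image.
  by_cases hid : i < d ∨ (i = d ∧ unif n i ≤ t d)
  · refine h.load_le_of_uniform_right hα hα1 ht.lt ht.mono ?_ ?_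
    · intro k hk hkn
      rw [ht.right k hk hkn, if_neg (by omega)]
      rfl
    · intro k hk
      rw [← unif_add_unif]
      refine add_le_add ?_ ?_
      · rw [ht.left k hk]
        exact hu (by split_ifs <;> omega)
      · rcases lt_or_eq_of_le (show k + 1 ≤ d from hk) with hk1 | rfl
        · rw [ht.left (k + 1) hk1]
          exact hu (by split_ifs <;> omega)
        · rcases hid with hid | ⟨rfl, hid⟩
          · refine le_trans ?_ (ht.mono (Nat.le_succ k))
            rw [ht.left k hk, if_neg (by omega)]
          · exact hid
  · refine h.load_le_of_uniform_left hα hα1 ht.lt ht.mono ?_ ?_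
    · intro k hk
      rw [ht.left k hk, if_pos (by omega)]
      rfl
    · intro k hk hkn
      rw [← unif_add_unif]
      refine add_le_add ?_ ?_
      · rcases lt_or_eq_of_le hk with hk1 | rfl
        · rw [ht.right k hk1 (by omega)]
          exact hu (by split_ifs <;> omega)
        · by_cases hdi : i = d
          · subst hdi
            exact le_of_not_ge fun h => hid (Or.inr ⟨rfl, h⟩)
          · refine (ht.mono (Nat.le_succ d)).trans ?_
            rw [Nat.succ_eq_add_one, ht.right (d + 1) (by omega) (by omega), if_pos (by omega)]
            rfl
      · rw [ht.right (k + 1) (by omega) hkn]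
        exact hu (by split_ifs <;> omega)

/-! ### The case `α = 0`. -/

/-- The borders if the clients only care for the distance. -/
noncomputable def midBorder (n : ℕ) (t : ℕ → ℝ) (k : ℕ) : ℝ :=
  if k = 0 then 0 else if k = n then 1 else (t (k - 1) + t k) / 2

lemma isBorderSystem_midBorder {n : ℕ} (hn : 0 < n) {t : ℕ → ℝ} (ht : Monotone t) :
    IsBorderSystem 0 n t (midBorder n t) := by
  refine ⟨by simp [midBorder], by simp [midBorder, hn.ne'], fun k hk => ?_⟩
  have h := ht (Nat.le_succ k)
  simp only [Nat.succ_eq_add_one] at h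
  have h1 : midBorder n t (k + 1) = (t k + t (k + 1)) / 2 := by
    rw [midBorder, if_neg (by omega), if_neg (by omega), Nat.add_sub_cancel]
  rw [le_antisymm (distGap_nonpos h (by linarith)) (distGap_nonneg h (by linarith))]
  ring

lemma midBorder_le_succ {n : ℕ} {t : ℕ → ℝ} (ht : Monotone t) (ht0 : 0 ≤ t 0)
    (ht1 : ∀ k, t k ≤ 1) (k : ℕ) (hk : k < n) : midBorder n t k ≤ midBorder n t (k + 1) := by
  have h0 : ∀ k, 0 ≤ t k := fun k => ht0.trans (ht (Nat.zero_le k))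
  have h1 := ht (show k - 1 ≤ k by omega)
  have h2 := ht (Nat.le_succ k)
  simp only [Nat.succ_eq_add_one] at h2
  simp only [midBorder, Nat.add_sub_cancel, if_neg (Nat.succ_ne_zero k), if_neg hk.ne]
  split_ifs <;> linarith [h0 k, h0 (k + 1), ht1 k, ht1 (k - 1)]

/-- An inner facility gets half the distance between its neighbours, at most `1 / n`. The value `3 /
2` comes from the ends of the market, where the load is bounded by the distance from the end to the
only neighbour. -/
lemma midBorder_deviation_load_le {n i d : ℕ} {t : ℕ → ℝ} (hn : 2 ≤ n) (hi : i < n)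
    (ht : IsDeviation n i d t) :
    n * (midBorder n t (d + 1) - midBorder n t d) ≤ 3 / 2 := by
  have hn' : (0 : ℝ) < n := by exact_mod_cast (show 0 < n by omega)
  have hu := unif_mono n
  have hd := ht.lt
  rw [mul_comm, ← le_div_iff₀ hn']
  have hup : d + 1 < n → t (d + 1) ≤ unif n (d + 1) := fun h => by
    rw [ht.right (d + 1) (by omega) h]
    exact hu (by split_ifs <;> omega)
  have hlow : 0 < d → unif n (d - 1) ≤ t (d - 1) := fun h => by
    rw [ht.left (d - 1) (by omega)]
    exact hu (by split_ifs <;> omega)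
  have hm1 := ht.mono (Nat.le_succ d)
  have hm2 := ht.mono (show d - 1 ≤ d by omega)
  simp only [Nat.succ_eq_add_one] at hm1
  simp only [midBorder, Nat.add_sub_cancel, if_neg (Nat.succ_ne_zero d), if_neg hd.ne]
  rcases Nat.eq_zero_or_pos d with rfl | hd0
  · rw [if_neg (by omega), if_pos rfl]
    have h1 := hup (by omega)
    have h2 : unif n (0 + 1) = 3 / 2 / n := by unfold unif; push_cast; field_simp; norm_num
    linarith
  · rw [if_neg hd0.ne']
    have h1 := hlow hd0
    by_cases hdn : d + 1 = n
    · rw [if_pos hdn]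
      have h2 : unif n (d - 1) = 1 - 3 / 2 / n := by
        obtain ⟨m, rfl⟩ : ∃ m, d = m + 1 := ⟨d - 1, by omega⟩
        subst hdn
        simp only [unif, Nat.add_sub_cancel]
        push_cast at hn' ⊢
        field_simp
        ring
      linarith
    · rw [if_neg hdn]
      have h3 := hup (by omega)
      have h2 : unif n (d + 1) = unif n (d - 1) + 2 / n := by
        obtain ⟨m, rfl⟩ : ∃ m, d = m + 1 := ⟨d - 1, by omega⟩
        simp only [unif, Nat.add_sub_cancel]
        push_cast
        field_simp
        ring
      have h4 : (2 : ℝ) / n / 2 ≤ 3 / 2 / n := by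
        rw [div_div, mul_comm, ← div_div]
        gcongr
        norm_num
      linarith

/-! ### Choice of a proper equilibrium in every subgame. -/

lemma isBorderSystem_unif (α : ℝ) {n : ℕ} (hn : 0 < n) :
    IsBorderSystem α n (unif n) fun k => k / n := by
  have hn' : (n : ℝ) ≠ 0 := by exact_mod_cast hn.ne'
  refine ⟨by simp, div_self hn', fun k _ => ?_⟩
  have h := unif_mono n (Nat.le_succ k)
  simp only [Nat.succ_eq_add_one] at h
  have h1 := unif_add_unif (n := n) k
  push_cast
  rw [le_antisymm (distGap_nonpos h (by rw [h1])) (distGap_nonneg h (by rw [h1]))]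
  ring

lemma exists_sorted {n : ℕ} (hn : 0 < n) (s : Placement n) :
    ∃ (σ : Equiv.Perm (Fin n)) (t : ℕ → ℝ), Monotone t ∧ (∀ k : Fin n, t k = s (σ k)) ∧
      0 ≤ t 0 ∧ ∀ k, t k ≤ 1 := by
  -- Truncating the index continues the sequence constantly beyond `n - 1`, so that it is monotone
  -- on all of `ℕ`.
  refine ⟨Tuple.sort s, fun k => s (Tuple.sort s ⟨min k (n - 1), by omega⟩), ?_, ?_,
    (s _).2.1, fun k => (s _).2.2⟩
  · intro j k hjk
    exact Subtype.coe_le_coe.2 (Tuple.monotone_sort s (min_le_min_right _ hjk))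
  · intro k
    have : (⟨min (k : ℕ) (n - 1), by omega⟩ : Fin n) = k := Fin.ext (by simp; omega)
    simp only [this]

/-- A proper client equilibrium for the locations `s`, whose loads are known if at most one
facility leaves the uniform placement. -/
lemma exists_clientEquilibrium {α : ℝ} (hα : 0 ≤ α) (hα1 : α ≤ 1) {n : ℕ} (hn : 2 ≤ n)
    (s : Placement n) :
    ∃ g : ClientMap n, g.IsMeasurableMap ∧ g.IsClientEquilibrium α s ∧ g.IsProper s ∧
      (s = sOpt n → ∀ i, g.load i = 1 / n) ∧
      ∀ i x, s = Function.update (sOpt n) i x → n * g.load i ≤ deviationFactor n α := by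
  have hn0 : 0 < n := by omega
  have hn' : (n : ℝ) ≠ 0 := by exact_mod_cast hn0.ne'
  by_cases hs : s = sOpt n
  · subst hs
    obtain ⟨g, h1, h2, h3, h4⟩ := (isBorderSystem_unif α hn0).exists_clientMap hα1 hn0
      (s := sOpt n) (σ := 1) (unif_mono n) (fun k => (coe_sOpt k).symm)
      (fun k _ => by push_cast; gcongr; linarith)
    have h5 : ∀ i, g.load i = 1 / n := fun i => by
      have := h4 i
      rw [Equiv.Perm.one_apply] at this
      rw [this]; push_cast; ring
    refine ⟨g, h1, h2, h3, fun _ => h5, fun i _ _ => ?_⟩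
    rw [h5, mul_one_div_cancel hn']
    exact one_le_deviationFactor hα hα1 n
  · obtain ⟨σ, t, ht, hts, ht0, ht1⟩ := exists_sorted hn0 s
    obtain ⟨β, hβ, hmono, hdev⟩ : ∃ β, IsBorderSystem α n t β ∧ (∀ k < n, β k ≤ β (k + 1)) ∧
        ∀ i < n, ∀ d, IsDeviation n i d t → n * (β (d + 1) - β d) ≤ deviationFactor n α := by
      rcases hα.eq_or_lt with rfl | hα0
      · refine ⟨midBorder n t, isBorderSystem_midBorder hn0 ht, midBorder_le_succ ht ht0 ht1,
          fun i hi d hd => (midBorder_deviation_load_le hn hi hd).trans_eq ?_⟩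
        have : ∀ m, decay 0 m = 0 := fun m => by cases m <;> simp [decay]
        rw [deviationFactor, this]
        norm_num
      · obtain ⟨β, hβ⟩ := exists_isBorderSystem hα0 hα1 hn0 ht
        exact ⟨β, hβ, hβ.monotoneOn hα0 hα1 ht ht0 ht1,
          fun i hi d hd => hβ.deviation_load_le hα0 hα1 hi hd⟩
    obtain ⟨g, h1, h2, h3, h4⟩ := hβ.exists_clientMap hα1 hn0 ht hts hmono
    refine ⟨g, h1, h2, h3, fun h => absurd h hs, fun i x hix => ?_⟩
    subst hix
    have := h4 (σ.symm i)
    rw [Equiv.apply_symm_apply] at this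
    rw [this]
    exact hdev i i.2 _ (isDeviation_of_sorted ht hts)

/-! ### Closed forms of the factor, the limit, and the theorem. -/

/-- Denominators of the continued fraction `decay`. -/
noncomputable def decayDen (α : ℝ) : ℕ → ℝ
  | 0 => 1
  | 1 => 2
  | m + 2 => 2 * decayDen α (m + 1) - α ^ 2 * decayDen α m

lemma decayDen_pos_and_decay_eq {α : ℝ} (h0 : 0 ≤ α) (h1 : α ≤ 1) (m : ℕ) :
    0 < decayDen α m ∧ 0 < decayDen α (m + 1) ∧
      decay α (m + 1) = α ^ 2 * decayDen α m / decayDen α (m + 1) := by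
  induction m with
  | zero => simp [decayDen, decay]
  | succ m ih =>
    obtain ⟨_, hp, hq⟩ := ih
    have hlt : 0 < 2 - decay α (m + 1) := by linarith [(decay_mem h0 h1 (m + 1)).2]
    have heq : decayDen α (m + 2) = decayDen α (m + 1) * (2 - decay α (m + 1)) := by
      rw [hq, decayDen]; field_simp
    have hp2 : 0 < decayDen α (m + 2) := heq ▸ mul_pos hp hlt
    refine ⟨hp, hp2, ?_⟩
    rw [show m + 1 + 1 = m + 2 from rfl, heq, decay]
    field_simp

lemma deviationFactor_eq {α : ℝ} (h0 : 0 ≤ α) (h1 : α ≤ 1) (m : ℕ) :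
    0 < (1 + α) * decayDen α (m + 1) - α ^ 2 * decayDen α m ∧
      deviationFactor (m + 3) α = 1 + (1 - α) * decayDen α (m + 1) /
        (2 * ((1 + α) * decayDen α (m + 1) - α ^ 2 * decayDen α m)) := by
  obtain ⟨_, hp, hq⟩ := decayDen_pos_and_decay_eq h0 h1 m
  have hw : 0 < 1 + α - decay α (m + 1) := by
    rcases h0.eq_or_lt with rfl | h0
    · rw [hq]; norm_num
    · linarith [(decay_mem h0.le h1 (m + 1)).2]
  have heq : (1 + α) * decayDen α (m + 1) - α ^ 2 * decayDen α m =
      decayDen α (m + 1) * (1 + α - decay α (m + 1)) := by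
    rw [hq]; field_simp
  refine ⟨heq ▸ mul_pos hp hw, ?_⟩
  rw [heq, deviationFactor, show m + 3 - 2 = m + 1 by omega]
  field_simp

/-- `s` is the sign relating the denominator of `rhoOpt` to the positive denominator `Q` from
`deviationFactor_eq`. -/
lemma div_eq_one_add_div {N D Q r s : ℝ} (hQ : 0 < Q) (hs : s ^ 2 = 1) (hD : D = s * Q)
    (hN : 2 * (s * N) = 2 * Q + r) : N / D = 1 + r / (2 * Q) := by
  have hN' : N = s * (2 * Q + r) / 2 := by
    rw [← hN]; linear_combination (-N) * hs
  have hs0 : s ≠ 0 := by rintro rfl; norm_num at hs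
  rw [hD, hN']
  field_simp

lemma rhoOpt_eq_deviationFactor {n : ℕ} (hn : 4 ≤ n) (hn' : n ≤ 10) {α : ℝ} (h0 : 0 ≤ α)
    (h1 : α ≤ 1) : rhoOpt n α = deviationFactor n α := by
  obtain ⟨m, rfl⟩ : ∃ m, n = m + 3 := ⟨n - 3, by omega⟩
  obtain ⟨hQ, hF⟩ := deviationFactor_eq h0 h1 m
  -- For even `n` the factor is stated as `1 / 2` plus a fraction, for odd `n` as a single fraction.
  have half : ∀ {N D Q r s : ℝ}, 0 < Q → s ^ 2 = 1 → D = s * Q → 2 * (s * N) = Q + r →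
      1 / 2 + N / D = 1 + r / (2 * Q) := by
    intro N D Q r s hQ hs hD hN
    have h := div_eq_one_add_div (N := N) (r := r - Q) hQ hs hD (by linarith)
    rw [h, sub_div, div_mul_cancel_right₀ hQ.ne']
    ring
  rw [hF]
  have hm1 : 1 ≤ m := by omega
  have hm2 : m ≤ 7 := by omega
  clear hn hn' hF
  interval_cases m <;> simp only [rhoOpt, decayDen] at hQ ⊢
  · exact half (s := -1) hQ (by norm_num) (by ring) (by ring)
  · exact div_eq_one_add_div (s := 1) hQ (by norm_num) (by ring) (by ring)
  · exact half (s := 1) hQ (by norm_num) (by ring) (by ring)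
  · exact div_eq_one_add_div (s := -1) hQ (by norm_num) (by ring) (by ring)
  · exact half (s := -1) hQ (by norm_num) (by ring) (by ring)
  · exact div_eq_one_add_div (s := 1) hQ (by norm_num) (by ring) (by ring)
  · exact half (s := 1) hQ (by norm_num) (by ring) (by ring)

lemma tendsto_deviationFactor (n : ℕ) :
    Tendsto (deviationFactor n) (𝓝[>] 0) (𝓝 (3 / 2)) := by
  have hid : Tendsto (fun α : ℝ => α) (𝓝[>] 0) (𝓝 0) :=
    tendsto_nhdsWithin_of_tendsto_nhds tendsto_id
  have hmem : ∀ᶠ α : ℝ in 𝓝[>] 0, 0 ≤ α ∧ α ≤ 1 := by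
    filter_upwards [Ioc_mem_nhdsGT (zero_lt_one' ℝ)] with α hα using ⟨hα.1.le, hα.2⟩
  have hdecay : ∀ m, Tendsto (fun α => decay α m) (𝓝[>] 0) (𝓝 0) := by
    intro m
    have hsq : Tendsto (fun α : ℝ => α ^ 2) (𝓝[>] 0) (𝓝 0) := by
      simpa using hid.pow 2
    refine tendsto_of_tendsto_of_tendsto_of_le_of_le' tendsto_const_nhds hsq ?_ ?_
    · filter_upwards [hmem] with α hα using (decay_mem hα.1 hα.2 m).1
    · filter_upwards [hmem] with α hα
      cases m with
      | zero => exact sq_nonneg α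
      | succ m =>
        exact div_le_self (sq_nonneg α) (by linarith [(decay_mem hα.1 hα.2 m).2])
  have h1 : Tendsto (fun α => 2 * (1 + α - decay α (n - 2))) (𝓝[>] 0) (𝓝 (2 * (1 + 0 - 0))) :=
    ((hid.const_add 1).sub (hdecay _)).const_mul 2
  have h2 := (((hid.const_sub 1).div h1 (by norm_num)).const_add 1)
  norm_num at h2
  exact h2

theorem mainTheorem7 (n : ℕ) (hn : 4 ≤ n) (hn' : n ≤ 10) :
    (∀ α : ℝ, 0 ≤ α → α ≤ 1 →
      (∃ f : ChoiceFunction n,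
        (∀ s : Placement n, (f s).IsProper s) ∧ IsApproxSPE (rhoOpt n α) α (sOpt n) f) ∧
      (0 < α → ∀ f : ChoiceFunction n,
        f.IsSubgameEquilibrium α → IsApproxSPE (rhoOpt n α) α (sOpt n) f)) ∧
    Tendsto (rhoOpt n) (𝓝[>] 0) (𝓝 (3 / 2)) := by
  have hn0 : (0 : ℝ) < n := by exact_mod_cast (show 0 < n by omega)
  refine ⟨fun α h0 h1 => ?_, ?_⟩
  · choose g hmeas heq hprop hopt hdev using exists_clientEquilibrium h0 h1 (show 2 ≤ n by omega)
    have hbound : ∀ i x, (g (Function.update (sOpt n) i x)).load i ≤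
        rhoOpt n α * (g (sOpt n)).load i := by
      intro i x
      rw [hopt _ rfl, rhoOpt_eq_deviationFactor hn hn' h0 h1, mul_one_div, le_div_iff₀ hn0,
        mul_comm]
      exact hdev _ i x rfl
    refine ⟨⟨g, hprop, hbound, fun s => ⟨hmeas s, heq s⟩⟩, fun hα f hf => ⟨fun i x => ?_, hf⟩⟩
    -- Uniqueness of loads carries the bound from the constructed choice function to an arbitrary
    -- one.
    have hload : ∀ s i, (f s).load i = (g s).load i := fun s i =>
      ClientMap.IsClientEquilibrium.load_eq hα (hf s).1 (hmeas s) (hf s).2 (heq s) i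
    rw [hload, hload]
    exact hbound i x
  · refine (tendsto_deviationFactor n).congr' ?_
    filter_upwards [Ioc_mem_nhdsGT (zero_lt_one' ℝ)] with α hα
    exact (rhoOpt_eq_deviationFactor hn hn' hα.1.le hα.2).symm
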